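/- Let $L_0,S_0\in\mathbb{R}^{m\times n}$, let $M=L_0+S_0$ and $r=\operatorname{rank}(L_0)$, and let $L_l\in\mathbb{R}^{m\times k}$ satisfy $\operatorname{Range}(L_l)=\operatorname{Range}(L_0)$. Let $\mathcal{U}_0=\operatorname{Range}(L_0)$ and suppose that $L_0$ has column-space incoherence parameter $\mu$, that is, $\|P_{\mathcal{U}_0}e_i\|_2^2\le \mu r/m$ for every standard basis vector $e_i$ of $\mathbb{R}^m$. Let $\xi_1,\dots,\xi_m$ be independent $\mathrm{Ber}(p_0)$ random variables. For a matrix $A$ with $m$ rows let $\mathcal{Y}'(A)$ be the matrix obtained by keeping row $i$ of $A$ if $\xi_i=1$ and replacing it by zero if $\xi_i=0$, and for $x\in\mathbb{R}^m$ let $\mathcal{Z}'(x)=(\xi_i x_i)_i$. Let $\delta>0$ and suppose that $$p_0\ \ge\ 2\mu\,\frac{r}{m}\,\log\frac{r}{\delta}.$$ (If $r=0$, the right-hand side is read as $0$.) Then, with probability at least $1-\delta$, all of the following hold: 1. $\operatorname{rank}(\mathcal{Y}'(L_l))=r$; 2. $\operatorname{Range}(\mathcal{Y}'(L_l))=\operatorname{Range}(\mathcal{Y}'(L_0))$;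 3. for every column index $j$, the least-squares filtering problem $$\min_{q,z}\ \|z\|_2\quad\text{subject to}\quad \mathcal{Z}'(M_{:j})=\mathcal{Y}'(L_l)\,q+z$$ has a solution, and every solution $(q,z)$ satisfies $z\neq 0$ if and only if $\mathcal{Z}'(M_{:j})\notin\operatorname{Range}(\mathcal{Y}'(L_0))$. In particular, filtering correctly decides whether column $j$ is an outlier: if $(S_0)_{:j}=0$, or if the noise $(S_0)_{:j}$ is identifiable from its observed entries in the sense that $\mathcal{Z}'((S_0)_{:j})\notin\operatorname{Range}(\mathcal{Y}'(L_0))$, then $z\ne0$ if and only if $(S_0)_{:j}\neq 0$. -/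

import Mathlib

open MeasureTheory ProbabilityTheory

noncomputable section

/-- The column space (range) of a real matrix, as a subspace of Euclidean space. -/
def columnSpace {m n : ℕ} (A : Matrix (Fin m) (Fin n) ℝ) :
    Submodule ℝ (EuclideanSpace ℝ (Fin m)) :=
  LinearMap.range (Matrix.toEuclideanLin A)

/-- The `j`-th column of a matrix, as a Euclidean vector. -/
def column {m n : ℕ} (A : Matrix (Fin m) (Fin n) ℝ) (j : Fin n) : EuclideanSpace ℝ (Fin m) :=
  WithLp.toLp 2 (fun i => A i j)

/-- `A` is `μ`-incoherent on its column space `U`: every standard basis vector `e i` satisfies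
`‖P_U (e i)‖ ^ 2 ≤ μ * rank A / m`. -/
def IsColumnSpaceIncoherent {m n : ℕ} (A : Matrix (Fin m) (Fin n) ℝ) (μ : ℝ) : Prop :=
  ∀ i : Fin m,
    ‖(columnSpace A).starProjection (EuclideanSpace.single i (1 : ℝ))‖ ^ 2 ≤ μ * A.rank / m

/-- Row sampling with selectors `d i ∈ {0, 1}`: row `i` of `A` is kept if `d i = 1` and wiped out
(replaced by zero) if `d i = 0`. -/
def sampleRows {m n : ℕ} (d : Fin m → ℝ) (A : Matrix (Fin m) (Fin n) ℝ) :
    Matrix (Fin m) (Fin n) ℝ :=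
  Matrix.of fun i j => d i * A i j

/-- The same sampling applied to a vector: the unobserved entries are wiped out. -/
def sampleEntries {m : ℕ} (d : Fin m → ℝ) (x : EuclideanSpace ℝ (Fin m)) :
    EuclideanSpace ℝ (Fin m) :=
  WithLp.toLp 2 (fun i => d i * x i)

/-- `(q, z)` solves the least-squares problem: minimize `‖z‖` over all `(q, z)` subject to
`b = A q + z`. -/
def IsLeastSquaresSolution {m k : ℕ} (A : Matrix (Fin m) (Fin k) ℝ)
    (b : EuclideanSpace ℝ (Fin m)) (q : EuclideanSpace ℝ (Fin k))
    (z : EuclideanSpace ℝ (Fin m)) : Prop :=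
  b = Matrix.toEuclideanLin A q + z ∧
    ∀ (q' : EuclideanSpace ℝ (Fin k)) (z' : EuclideanSpace ℝ (Fin m)),
      b = Matrix.toEuclideanLin A q' + z' → ‖z‖ ≤ ‖z'‖

end

/-! For a set `S` of sampled rows, let `K_S` be the space of vectors of `U = Range(L₀)` vanishing on
`S`. If `K_S = 0`, sampling is injective on `U`, so rank survives; the remaining claims are
deterministic linear algebra. It remains to bound the probability that `K_S ≠ 0`, which by Markov is
at most the mean `F(p)` of `dim K_S`.

With `R = μ r / m`, the numbers `‖P_{K_S} e_i‖²` sum to `dim K_S`, are each at most `R`, and vanish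
unless sampling `i` lowers the dimension. Hence at least `dim K_S / R` further rows lower it
(`finrank_vanishingSubspace_le`). Russo's formula for `F'` turns this into `F ≤ -R F'`, so `F(p) ≤ r
exp(-p / R) ≤ δ` (`sum_binomial_weight_le_exp`). No matrix concentration inequality is needed. -/

open Finset in
/-- Derivative in `p` of the expectation of `g` at a random subset that contains each element
independently with probability `p`. -/
lemma hasDerivAt_sum_binomial_weight {ι : Type*} [Fintype ι] [DecidableEq ι]
    (g : Finset ι → ℝ) (p : ℝ) :
    HasDerivAt (fun p : ℝ => ∑ S : Finset ι, p ^ #S * (1 - p) ^ #Sᶜ * g S)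
      (∑ T : Finset ι, ∑ i ∈ Tᶜ, p ^ #T * (1 - p) ^ (#Tᶜ - 1) * (g (insert i T) - g T)) p := by
  have h : ∀ S ∈ (univ : Finset (Finset ι)),
      HasDerivAt (fun p : ℝ => p ^ #S * (1 - p) ^ #Sᶜ * g S)
        (((#S * p ^ (#S - 1)) * (1 - p) ^ #Sᶜ
          + p ^ #S * (#Sᶜ * (1 - p) ^ (#Sᶜ - 1) * (-1))) * g S) p := by
    intro S _
    exact ((hasDerivAt_pow #S p).mul
      (((hasDerivAt_id p).const_sub 1).pow #Sᶜ)).mul_const (g S)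
  refine (HasDerivAt.fun_sum h).congr_deriv ?_
  -- Reindex by `(T, i) ↦ (T ∪ {i}, i)`: pairs with `i ∉ T` correspond to pairs with `i ∈ S`.
  have hre : ∑ T : Finset ι, ∑ i ∈ Tᶜ, p ^ #T * (1 - p) ^ (#Tᶜ - 1) * g (insert i T)
      = ∑ S : Finset ι, ∑ i ∈ S, p ^ (#S - 1) * (1 - p) ^ #Sᶜ * g S := by
    rw [sum_sigma', sum_sigma']
    refine sum_bij' (fun x _ => ⟨insert x.2 x.1, x.2⟩) (fun x _ => ⟨x.1.erase x.2, x.2⟩)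
      ?_ ?_ ?_ ?_ ?_
    · rintro ⟨T, i⟩ _
      simp
    · rintro ⟨S, i⟩ _
      simp
    · rintro ⟨T, i⟩ h
      simp only [mem_sigma, mem_univ, true_and, mem_compl] at h
      simp [h]
    · rintro ⟨S, i⟩ h
      simp only [mem_sigma, mem_univ, true_and] at h
      simp [h]
    · rintro ⟨T, i⟩ h
      simp only [mem_sigma, mem_univ, true_and, mem_compl] at h
      simp [h, compl_insert, card_erase_of_mem]
  simp_rw [mul_sub, sum_sub_distrib, hre, ← sum_sub_distrib]
  refine sum_congr rfl fun S _ => ?_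
  simp only [sum_const, nsmul_eq_mul]
  ring

open Finset in
/-- If the expected one-element decrements of `g` dominate `g / R`, then the mean of `g` at a
random subset of density `p` is at most `g ∅ * exp (-p / R)`. -/
lemma sum_binomial_weight_le_exp {ι : Type*} [Fintype ι] [DecidableEq ι]
    (g : Finset ι → ℝ) {R : ℝ} (hR : 0 < R)
    (hanti : ∀ T i, g (insert i T) ≤ g T)
    (hg : ∀ T, g T ≤ R * ∑ i ∈ Tᶜ, (g T - g (insert i T)))
    {p : ℝ} (hp0 : 0 ≤ p) (hp1 : p ≤ 1) :
    ∑ S : Finset ι, p ^ #S * (1 - p) ^ #Sᶜ * g S ≤ g ∅ * Real.exp (-p / R) := by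
  set f : ℝ → ℝ := fun p => ∑ S : Finset ι, p ^ #S * (1 - p) ^ #Sᶜ * g S with hf
  set f' : ℝ → ℝ := fun p =>
    ∑ T : Finset ι, ∑ i ∈ Tᶜ, p ^ #T * (1 - p) ^ (#Tᶜ - 1) * (g (insert i T) - g T) with hf'
  -- Integrating factor: `f ≤ -R f'` makes `f x * exp (x / R)` antitone on `[0, 1]`.
  have hd : ∀ x, HasDerivAt (fun x => f x * Real.exp (x / R))
      (f' x * Real.exp (x / R) + f x * (Real.exp (x / R) * (1 / R))) x := fun x =>
    (hasDerivAt_sum_binomial_weight g x).mul (((hasDerivAt_id x).div_const R).exp)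
  have hle : ∀ x, 0 ≤ x → x ≤ 1 → f x ≤ -(R * f' x) := by
    intro x hx0 hx1
    have h1x : 0 ≤ 1 - x := by linarith
    rw [hf, hf', mul_sum, ← sum_neg_distrib]
    refine sum_le_sum fun T _ => ?_
    calc x ^ #T * (1 - x) ^ #Tᶜ * g T
        ≤ x ^ #T * (1 - x) ^ #Tᶜ * (R * ∑ i ∈ Tᶜ, (g T - g (insert i T))) := by
          gcongr
          exact hg T
      -- Dropping one factor `1 - x ≤ 1` matches the weight in `f'`. For `T = univ` the truncated
      -- exponent is harmless, as the sum over `Tᶜ` is empty.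
      _ ≤ x ^ #T * (1 - x) ^ (#Tᶜ - 1) * (R * ∑ i ∈ Tᶜ, (g T - g (insert i T))) := by
          have : 0 ≤ ∑ i ∈ Tᶜ, (g T - g (insert i T)) :=
            sum_nonneg fun i _ => sub_nonneg.2 (hanti T i)
          gcongr ?_ * ?_ * _
          exact pow_le_pow_of_le_one h1x (by linarith) (Nat.sub_le _ _)
      _ = -(R * ∑ i ∈ Tᶜ, x ^ #T * (1 - x) ^ (#Tᶜ - 1) * (g (insert i T) - g T)) := by
          rw [← mul_sum, sum_sub_distrib, sum_sub_distrib]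
          ring
  have hanti' : AntitoneOn (fun x => f x * Real.exp (x / R)) (Set.Icc 0 1) := by
    refine antitoneOn_of_deriv_nonpos (convex_Icc 0 1)
      (fun x _ => (hd x).continuousAt.continuousWithinAt)
      (fun x _ => (hd x).differentiableAt.differentiableWithinAt) fun x hx => ?_
    rw [interior_Icc] at hx
    rw [(hd x).deriv]
    have h := hle x hx.1.le hx.2.le
    have : f' x * Real.exp (x / R) + f x * (Real.exp (x / R) * (1 / R))
        = (R * f' x + f x) * (Real.exp (x / R) / R) := by
      field_simp
    rw [this]
    exact mul_nonpos_of_nonpos_of_nonneg (by linarith) (by positivity)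
  have h0 : f 0 = g ∅ := by
    rw [hf]
    dsimp only
    rw [Finset.sum_eq_single ∅]
    · simp
    · intro S _ hS
      simp [hS]
    · simp
  have h := hanti' (Set.left_mem_Icc.2 zero_le_one) ⟨hp0, hp1⟩ hp0
  simp only [h0, zero_div, Real.exp_zero, mul_one] at h
  rw [neg_div, Real.exp_neg, ← div_eq_mul_inv, le_div_iff₀ (Real.exp_pos _)]
  exact h

/-! ### Vectors of a subspace vanishing on the sample -/

/-- The vectors of `U` whose coordinates in `S` vanish. -/
def vanishingSubspace {m : ℕ} (U : Submodule ℝ (EuclideanSpace ℝ (Fin m))) (S : Finset (Fin m)) :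
    Submodule ℝ (EuclideanSpace ℝ (Fin m)) where
  carrier := {x | x ∈ U ∧ ∀ i ∈ S, x i = 0}
  add_mem' := fun hx hy => ⟨U.add_mem hx.1 hy.1, fun i hi => by simp [hx.2 i hi, hy.2 i hi]⟩
  zero_mem' := ⟨U.zero_mem, fun i _ => by simp⟩
  smul_mem' := fun c x hx => ⟨U.smul_mem c hx.1, fun i hi => by simp [hx.2 i hi]⟩

lemma mem_vanishingSubspace {m : ℕ} {U : Submodule ℝ (EuclideanSpace ℝ (Fin m))}
    {S : Finset (Fin m)} {x : EuclideanSpace ℝ (Fin m)} :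
    x ∈ vanishingSubspace U S ↔ x ∈ U ∧ ∀ i ∈ S, x i = 0 := Iff.rfl

lemma vanishingSubspace_le {m : ℕ} (U : Submodule ℝ (EuclideanSpace ℝ (Fin m)))
    (S : Finset (Fin m)) : vanishingSubspace U S ≤ U := fun _ h => h.1

lemma vanishingSubspace_empty {m : ℕ} (U : Submodule ℝ (EuclideanSpace ℝ (Fin m))) :
    vanishingSubspace U ∅ = U := by
  ext x
  simp [mem_vanishingSubspace]

lemma vanishingSubspace_insert_le {m : ℕ} (U : Submodule ℝ (EuclideanSpace ℝ (Fin m)))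
    (S : Finset (Fin m)) (i : Fin m) :
    vanishingSubspace U (insert i S) ≤ vanishingSubspace U S :=
  fun _ h => ⟨h.1, fun j hj => h.2 j (Finset.mem_insert_of_mem hj)⟩

/-- Both sides are the trace of the orthogonal projection onto `K`. -/
lemma sum_norm_sq_starProjection_single {m : ℕ} (K : Submodule ℝ (EuclideanSpace ℝ (Fin m))) :
    ∑ i : Fin m, ‖K.starProjection (EuclideanSpace.single i (1 : ℝ))‖ ^ 2
      = Module.finrank ℝ K := by
  have hproj : LinearMap.IsProj K (K.starProjection : _ →ₗ[ℝ] EuclideanSpace ℝ (Fin m)) :=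
    ⟨fun x => K.starProjection_apply_mem x, fun x hx => K.starProjection_eq_self_iff.2 hx⟩
  rw [← hproj.trace, LinearMap.trace_eq_sum_inner _ (EuclideanSpace.basisFun (Fin m) ℝ)]
  refine Finset.sum_congr rfl fun i _ => ?_
  have h := K.re_inner_starProjection_eq_normSq (EuclideanSpace.single i (1 : ℝ))
  rw [real_inner_comm] at h
  simpa using h.symm

lemma norm_starProjection_le_of_le {m : ℕ} {K U : Submodule ℝ (EuclideanSpace ℝ (Fin m))}
    (h : K ≤ U) (x : EuclideanSpace ℝ (Fin m)) :
    ‖K.starProjection x‖ ≤ ‖U.starProjection x‖ := by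
  rw [← Submodule.starProjection_comp_starProjection_of_le h]
  exact K.norm_starProjection_apply_le _

open Finset in
/-- Each further sampled coordinate on which `vanishingSubspace U T` is nonzero lowers its
dimension, and incoherence of `U` forces many such coordinates. -/
lemma finrank_vanishingSubspace_le {m : ℕ} (U : Submodule ℝ (EuclideanSpace ℝ (Fin m))) {R : ℝ}
    (hR : 0 ≤ R)
    (hU : ∀ i, ‖U.starProjection (EuclideanSpace.single i (1 : ℝ))‖ ^ 2 ≤ R)
    (T : Finset (Fin m)) :
    (Module.finrank ℝ (vanishingSubspace U T) : ℝ) ≤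
      R * ∑ i ∈ Tᶜ, ((Module.finrank ℝ (vanishingSubspace U T) : ℝ)
        - Module.finrank ℝ (vanishingSubspace U (insert i T))) := by
  set K := vanishingSubspace U T with hK
  have hzero : ∀ i, (∀ x ∈ K, x i = 0) →
      ‖K.starProjection (EuclideanSpace.single i (1 : ℝ))‖ ^ 2 = 0 := by
    intro i hi
    have : K.starProjection (EuclideanSpace.single i (1 : ℝ)) = 0 := by
      rw [Submodule.starProjection_apply_eq_zero_iff, Submodule.mem_orthogonal]
      intro x hx
      simp [EuclideanSpace.inner_single_right, hi x hx]
    simp [this]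
  have htrace := sum_norm_sq_starProjection_single K
  rw [← sum_add_sum_compl T, sum_eq_zero fun i hi => hzero i fun x hx => hx.2 i hi,
    zero_add] at htrace
  refine htrace.symm.le.trans ?_
  rw [mul_sum]
  refine sum_le_sum fun i _ => ?_
  by_cases hi : ∀ x ∈ K, x i = 0
  · rw [hzero i hi]
    exact mul_nonneg hR (sub_nonneg.2 (Nat.cast_le.2
      (Submodule.finrank_mono (vanishingSubspace_insert_le U T i))))
  · push Not at hi
    obtain ⟨x, hx, hxi⟩ := hi
    have hlt : vanishingSubspace U (insert i T) < K :=
      lt_of_le_of_ne (vanishingSubspace_insert_le U T i) fun h => by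
        rw [← h] at hx
        exact hxi (hx.2 i (mem_insert_self i T))
    have h1 : (Module.finrank ℝ (vanishingSubspace U (insert i T)) : ℝ) + 1
        ≤ Module.finrank ℝ K := by
      exact_mod_cast Submodule.finrank_lt_finrank_of_lt hlt
    calc ‖K.starProjection (EuclideanSpace.single i (1 : ℝ))‖ ^ 2
        ≤ ‖U.starProjection (EuclideanSpace.single i (1 : ℝ))‖ ^ 2 := by
          gcongr
          exact norm_starProjection_le_of_le (vanishingSubspace_le U T) _
      _ ≤ R := hU i
      _ = R * 1 := (mul_one R).symm
      _ ≤ _ := by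
          gcongr
          linarith

/-! ### Row sampling, rank and least squares -/

lemma rank_eq_finrank_columnSpace {m n : ℕ} (A : Matrix (Fin m) (Fin n) ℝ) :
    A.rank = Module.finrank ℝ (columnSpace A) := by
  rw [A.rank_eq_finrank_range_toLin (EuclideanSpace.basisFun (Fin m) ℝ).toBasis
    (EuclideanSpace.basisFun (Fin n) ℝ).toBasis, columnSpace,
    Matrix.toEuclideanLin_eq_toLin_orthonormal]

/-- `sampleEntries` as a linear map. -/
def sampleEntriesLin {m : ℕ} (d : Fin m → ℝ) :
    EuclideanSpace ℝ (Fin m) →ₗ[ℝ] EuclideanSpace ℝ (Fin m) where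
  toFun := sampleEntries d
  map_add' x y := by ext i; simp [sampleEntries, mul_add]
  map_smul' c x := by ext i; simp [sampleEntries]; ring

lemma sampleEntriesLin_apply {m : ℕ} (d : Fin m → ℝ) (x : EuclideanSpace ℝ (Fin m)) :
    sampleEntriesLin d x = sampleEntries d x := rfl

lemma columnSpace_sampleRows {m n : ℕ} (d : Fin m → ℝ) (A : Matrix (Fin m) (Fin n) ℝ) :
    columnSpace (sampleRows d A) = (columnSpace A).map (sampleEntriesLin d) := by
  rw [columnSpace, columnSpace, ← LinearMap.range_comp]
  congr 1
  ext1 x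
  ext i
  simp [sampleEntriesLin_apply, sampleEntries, sampleRows, Matrix.mulVec, dotProduct,
    Finset.mul_sum, mul_assoc, Matrix.toLpLin_apply]

lemma column_mem_columnSpace {m n : ℕ} (A : Matrix (Fin m) (Fin n) ℝ) (j : Fin n) :
    column A j ∈ columnSpace A :=
  ⟨EuclideanSpace.single j 1, by ext i; simp [column, Matrix.toLpLin_apply]⟩

lemma exists_isLeastSquaresSolution {m k : ℕ} (A : Matrix (Fin m) (Fin k) ℝ)
    (b : EuclideanSpace ℝ (Fin m)) : ∃ q z, IsLeastSquaresSolution A b q z := by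
  obtain ⟨q, hq⟩ := (columnSpace A).starProjection_apply_mem b
  refine ⟨q, b - (columnSpace A).starProjection b, by rw [hq]; abel, fun q' z' h => ?_⟩
  rw [Submodule.starProjection_minimal]
  have hz : z' = b - Matrix.toEuclideanLin A q' := by rw [h]; abel
  rw [hz]
  exact ciInf_le ⟨0, by rintro _ ⟨x, rfl⟩; exact norm_nonneg _⟩
    (⟨_, LinearMap.mem_range_self _ q'⟩ : columnSpace A)

lemma IsLeastSquaresSolution.ne_zero_iff {m k : ℕ} {A : Matrix (Fin m) (Fin k) ℝ}
    {b : EuclideanSpace ℝ (Fin m)} {q : EuclideanSpace ℝ (Fin k)} {z : EuclideanSpace ℝ (Fin m)}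
    (h : IsLeastSquaresSolution A b q z) : z ≠ 0 ↔ b ∉ columnSpace A := by
  refine not_congr ⟨fun hz => ⟨q, by rw [h.1, hz, add_zero]⟩, fun ⟨q', hq'⟩ => ?_⟩
  -- An exact fit is feasible with residual `0`, so the minimal residual has norm `0`.
  have := h.2 q' 0 (by rw [hq', add_zero])
  simpa using this

/-- Two vectors of the column space with equal samples differ by a vector vanishing on `S`, so
sampling is injective there. -/
lemma rank_sampleRows_of_vanishingSubspace_eq_bot {m n : ℕ} (A : Matrix (Fin m) (Fin n) ℝ)
    {d : Fin m → ℝ} {S : Finset (Fin m)} (hd : ∀ i ∈ S, d i ≠ 0)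
    (hS : vanishingSubspace (columnSpace A) S = ⊥) : (sampleRows d A).rank = A.rank := by
  rw [rank_eq_finrank_columnSpace, rank_eq_finrank_columnSpace, columnSpace_sampleRows]
  rw [← LinearMap.range_domRestrict]
  refine LinearMap.finrank_range_of_inj ?_
  rintro ⟨x, hx⟩ ⟨y, hy⟩ hxy
  replace hxy : sampleEntriesLin d x = sampleEntriesLin d y := hxy
  have : x - y ∈ vanishingSubspace (columnSpace A) S := by
    refine ⟨Submodule.sub_mem _ hx hy, fun i hi => ?_⟩
    have h := congrArg (fun v : EuclideanSpace ℝ (Fin m) => v i) hxy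
    simp only [sampleEntriesLin_apply, sampleEntries] at h
    have := mul_left_cancel₀ (hd i hi) h
    simp [this]
  rw [hS, Submodule.mem_bot] at this
  exact Subtype.ext (sub_eq_zero.1 this)

/-- The sampled column of `L` already lies in the range, so only the noise matters. -/
lemma sampleEntries_column_add_mem_iff {m n : ℕ} (d : Fin m → ℝ)
    (L S : Matrix (Fin m) (Fin n) ℝ) (j : Fin n) :
    sampleEntries d (column (L + S) j) ∈ columnSpace (sampleRows d L) ↔
      sampleEntries d (column S j) ∈ columnSpace (sampleRows d L) := by
  have hadd : column (L + S) j = column L j + column S j := by ext i; simp [column]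
  rw [← sampleEntriesLin_apply, hadd, map_add]
  refine Submodule.add_mem_iff_right _ ?_
  rw [columnSpace_sampleRows]
  exact Submodule.mem_map_of_mem (column_mem_columnSpace L j)

/-! ### Bernoulli selectors as a random subset -/

open Finset in
lemma measureReal_bernoulli_eq_indicator {Ω ι : Type*} [MeasurableSpace Ω] {P : Measure Ω}
    [Fintype ι] [DecidableEq ι] {p : unitInterval} {ξ : ι → Ω → ℝ}
    (hlaw : ∀ i, HasLaw (ξ i) (bernoulliMeasure (1 : ℝ) 0 p) P) (hindep : iIndepFun ξ P)
    (S : Finset ι) :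
    P.real {ω | ∀ i, ξ i ω = if i ∈ S then 1 else 0} = (p : ℝ) ^ #S * (1 - p) ^ #Sᶜ := by
  have hset : {ω | ∀ i, ξ i ω = if i ∈ S then 1 else 0}
      = ⋂ i ∈ (univ : Finset ι), ξ i ⁻¹' {if i ∈ S then 1 else 0} := by
    ext ω
    simp
  have hone : ∀ i, P.real (ξ i ⁻¹' {if i ∈ S then 1 else 0}) = if i ∈ S then (p : ℝ) else 1 - p := by
    intro i
    have h := (hlaw i).measureReal_eq (p := fun x => x ∈ ({if i ∈ S then 1 else 0} : Set ℝ))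
      (measurableSet_singleton _)
    refine h.trans ?_
    classical
    rw [Set.ofPred_mem_eq, bernoulliMeasure_real_apply p (measurableSet_singleton _)]
    split_ifs <;> simp_all
  rw [hset, measureReal_def, hindep.measure_inter_preimage_eq_mul univ
    (fun i _ => measurableSet_singleton _), ENNReal.toReal_prod]
  simp_rw [← measureReal_def, hone]
  rw [prod_ite, prod_const, prod_const]
  congr 3 <;> ext <;> simp

open Finset in
/-- If `g` is at least `1` off the good subsets, a Bernoulli random subset is good with
probability at least one minus the mean of `g`. -/
lemma one_sub_sum_le_measureReal_bernoulli {Ω ι : Type*} [MeasurableSpace Ω] {P : Measure Ω}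
    [IsProbabilityMeasure P] [Fintype ι] [DecidableEq ι] {p : unitInterval} {ξ : ι → Ω → ℝ}
    (hlaw : ∀ i, HasLaw (ξ i) (bernoulliMeasure (1 : ℝ) 0 p) P) (hindep : iIndepFun ξ P)
    {good : Finset ι → Prop} {g : Finset ι → ℝ} (hg0 : ∀ S, 0 ≤ g S)
    (hg1 : ∀ S, ¬ good S → 1 ≤ g S) {E : Set Ω}
    (hE : ∀ S ω, good S → (∀ i, ξ i ω = if i ∈ S then 1 else 0) → ω ∈ E) :
    1 - ∑ S : Finset ι, (p : ℝ) ^ #S * (1 - p) ^ #Sᶜ * g S ≤ P.real E := by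
  classical
  set A : Finset ι → Set Ω := fun S => {ω | ∀ i, ξ i ω = if i ∈ S then 1 else 0} with hA
  have hp0 : (0 : ℝ) ≤ p := p.2.1
  have hp1 : (0 : ℝ) ≤ 1 - p := sub_nonneg.2 p.2.2
  have hdisj : Pairwise (Function.onFun Disjoint A) := by
    intro S T hST
    refine Set.disjoint_left.2 fun ω hS hT => hST ?_
    ext i
    have h := (hS i).symm.trans (hT i)
    by_cases h1 : i ∈ S <;> by_cases h2 : i ∈ T <;> simp_all
  -- The selectors are only a.e. measurable, and `E` need not be measurable: it is bounded below by
  -- the null-measurable union of good atoms.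
  have hnull : ∀ S, NullMeasurableSet (A S) P := by
    intro S
    have : A S = ⋂ i, ξ i ⁻¹' {if i ∈ S then 1 else 0} := by
      ext ω
      simp [hA]
    rw [this]
    exact .iInter fun i => (hlaw i).aemeasurable.nullMeasurableSet_preimage
      (measurableSet_singleton _)
  have hunion : P.real (⋃ S ∈ univ.filter good, A S)
      = ∑ S with good S, (p : ℝ) ^ #S * (1 - p) ^ #Sᶜ := by
    rw [measureReal_biUnion_finset₀ (fun S _ T _ h => (hdisj h).aedisjoint) fun S _ => hnull S]
    exact sum_congr rfl fun S _ => measureReal_bernoulli_eq_indicator hlaw hindep S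
  have hsub : (⋃ S ∈ univ.filter good, A S) ⊆ E := by
    intro ω hω
    simp only [Set.mem_iUnion, mem_filter, mem_univ, true_and] at hω
    obtain ⟨S, hS, h⟩ := hω
    exact hE S ω hS h
  have htot : ∑ S : Finset ι, (p : ℝ) ^ #S * (1 - p) ^ #Sᶜ = 1 := by
    simp_rw [card_compl]
    rw [Fintype.sum_pow_mul_eq_add_pow]
    simp
  refine le_trans ?_ (measureReal_mono hsub)
  rw [← sum_filter_add_sum_filter_not univ good] at htot
  rw [hunion, sub_le_comm, ← eq_sub_of_add_eq' htot, sum_filter]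
  refine sum_le_sum fun S _ => ?_
  split_ifs with h
  · exact mul_nonneg (by positivity) (hg0 S)
  · exact le_mul_of_one_le_right (by positivity) (hg1 S h)

lemma mul_exp_neg_div_le {r R δ p : ℝ} (hr : 0 < r) (hR : 0 < R) (hδ : 0 < δ) (hp0 : 0 ≤ p)
    (hp : 2 * R * Real.log (r / δ) ≤ p) : r * Real.exp (-p / R) ≤ δ := by
  have hlog : Real.log (r / δ) ≤ p / R := by
    rcases le_total (Real.log (r / δ)) 0 with h | h
    · exact h.trans (by positivity)
    · rw [le_div_iff₀ hR]
      -- Since the logarithm is nonnegative here, the factor `2` in the hypothesis is slack.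
      nlinarith
  rw [Real.log_le_iff_le_exp (by positivity), div_le_iff₀ hδ] at hlog
  rw [neg_div, Real.exp_neg, ← div_eq_mul_inv, div_le_iff₀ (Real.exp_pos _), mul_comm]
  exact hlog

theorem theorem4 {Ω : Type*} [MeasurableSpace Ω] (P : Measure Ω) [IsProbabilityMeasure P]
    (m n k : ℕ) (L₀ S₀ : Matrix (Fin m) (Fin n) ℝ) (Ll : Matrix (Fin m) (Fin k) ℝ)
    (hLl : columnSpace Ll = columnSpace L₀)
    (μ : ℝ) (hμ : IsColumnSpaceIncoherent L₀ μ)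
    (p₀ : unitInterval) (δ : ℝ) (hδ : 0 < δ)
    (hp₀ : 2 * μ * ((L₀.rank : ℝ) / m) * Real.log (L₀.rank / δ) ≤ (p₀ : ℝ))
    (ξ : Fin m → Ω → ℝ)
    (hξ_law : ∀ i, HasLaw (ξ i) (bernoulliMeasure (1 : ℝ) 0 p₀) P)
    (hξ_indep : iIndepFun ξ P) :
    1 - δ ≤ P.real {ω |
      (sampleRows (fun i => ξ i ω) Ll).rank = L₀.rank ∧
      columnSpace (sampleRows (fun i => ξ i ω) Ll) =
        columnSpace (sampleRows (fun i => ξ i ω) L₀) ∧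
      ∀ j : Fin n,
        (∃ q z, IsLeastSquaresSolution (sampleRows (fun i => ξ i ω) Ll)
          (sampleEntries (fun i => ξ i ω) (column (L₀ + S₀) j)) q z) ∧
        ∀ q z, IsLeastSquaresSolution (sampleRows (fun i => ξ i ω) Ll)
            (sampleEntries (fun i => ξ i ω) (column (L₀ + S₀) j)) q z →
          (z ≠ 0 ↔ sampleEntries (fun i => ξ i ω) (column (L₀ + S₀) j) ∉
            columnSpace (sampleRows (fun i => ξ i ω) L₀)) ∧
          ((column S₀ j ≠ 0 → sampleEntries (fun i => ξ i ω) (column S₀ j) ∉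
              columnSpace (sampleRows (fun i => ξ i ω) L₀)) →
            (z ≠ 0 ↔ column S₀ j ≠ 0))} := by
  set U := columnSpace L₀ with hU
  set R : ℝ := μ * L₀.rank / m with hR
  set g : Finset (Fin m) → ℝ := fun S => Module.finrank ℝ (vanishingSubspace U S) with hg
  have hg0 : ∀ S, 0 ≤ g S := fun S => Nat.cast_nonneg _
  have hg_empty : g ∅ = L₀.rank := by
    rw [hg]
    dsimp only
    rw [vanishingSubspace_empty, hU, rank_eq_finrank_columnSpace]
  have hmean : ∑ S : Finset (Fin m),
      (p₀ : ℝ) ^ S.card * (1 - p₀) ^ Sᶜ.card * g S ≤ δ := by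
    -- Rank zero is separate because the exponential bound needs `R > 0`.
    rcases Nat.eq_zero_or_pos L₀.rank with hr | hr
    · have hgz : ∀ S, g S = 0 := fun S => by
        refine le_antisymm ?_ (hg0 S)
        calc g S ≤ g ∅ := by
              rw [hg]
              dsimp only
              rw [vanishingSubspace_empty]
              exact Nat.cast_le.2 (Submodule.finrank_mono (vanishingSubspace_le U S))
          _ = 0 := by rw [hg_empty, hr, Nat.cast_zero]
      simp only [hgz, mul_zero, Finset.sum_const_zero]
      exact hδ.le
    · have hr' : (0 : ℝ) < L₀.rank := Nat.cast_pos.2 hr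
      have hRpos : 0 < R := by
        -- Summing incoherence over `i` gives `r ≤ m R`, which forces `R > 0`.
        have hle : (L₀.rank : ℝ) ≤ m * R := by
          rw [rank_eq_finrank_columnSpace, ← sum_norm_sq_starProjection_single]
          refine (Finset.sum_le_sum fun i _ => hμ i).trans ?_
          simp [hR]
        exact pos_of_mul_pos_right (hr'.trans_le hle) (Nat.cast_nonneg m)
      refine (sum_binomial_weight_le_exp g hRpos (fun T i => Nat.cast_le.2
        (Submodule.finrank_mono (vanishingSubspace_insert_le U T i)))
        (finrank_vanishingSubspace_le U hRpos.le hμ) p₀.2.1 p₀.2.2).trans ?_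
      rw [hg_empty]
      refine mul_exp_neg_div_le hr' hRpos hδ p₀.2.1 (le_of_eq_of_le ?_ hp₀)
      rw [hR]
      ring
  refine (sub_le_sub_left hmean 1).trans (one_sub_sum_le_measureReal_bernoulli hξ_law hξ_indep
    (good := fun S => vanishingSubspace U S = ⊥) hg0 (fun S hS => ?_) fun S ω hS hω => ?_)
  -- Markov's input: a nonzero space has dimension at least `1`.
  · exact Nat.one_le_cast.2 (Nat.one_le_iff_ne_zero.2 fun h => hS (Submodule.finrank_eq_zero.1 h))
  have hrange : columnSpace (sampleRows (fun i => ξ i ω) Ll) =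
      columnSpace (sampleRows (fun i => ξ i ω) L₀) := by
    rw [columnSpace_sampleRows, columnSpace_sampleRows, hLl]
  refine ⟨?_, hrange, fun j => ⟨exists_isLeastSquaresSolution _ _, fun q z hz => ?_⟩⟩
  · rw [rank_eq_finrank_columnSpace, hrange, ← rank_eq_finrank_columnSpace]
    exact rank_sampleRows_of_vanishingSubspace_eq_bot L₀
      (fun i hi => by rw [hω i, if_pos hi]; exact one_ne_zero) hS
  · have hiff := hz.ne_zero_iff
    rw [hrange] at hiff
    refine ⟨hiff, fun hid => ?_⟩
    rw [hiff, sampleEntries_column_add_mem_iff]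
    refine ⟨fun h h0 => h ?_, hid⟩
    rw [h0, ← sampleEntriesLin_apply, map_zero]
    exact Submodule.zero_mem _
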